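/- For a prime $p$ let $\mathbb Z_p$ denote the set of rational numbers whose denominator is not divisible by $p$; congruences mod $p$ are taken in $\mathbb Z_p$, that is, $x\equiv y \pmod p$ means $x-y\in p\,\mathbb Z_p$. Let $\left(\frac{\cdot}{p}\right)$ be the Legendre symbol, extended to $\mathbb Z_p$ by reduction mod $p$, and let $[x]$ be the greatest integer not exceeding $x$. Let $i=\sqrt{-1}$. For a prime $\pi$ of $\mathbb Z[i]$ not dividing $2$ with norm $N\pi$ and $\alpha\in\mathbb Z[i]$, the quartic residue symbol $\left(\frac{\alpha}{\pi}\right)_4$ is $0$ if $\pi\mid\alpha$, and otherwise is the unique $i^r$, $r\in\{0,1,2,3\}$, with $\alpha^{(N\pi-1)/4}\equiv i^r \pmod \pi$. The quartic Jacobi symbol $\left(\frac{\alpha}{p}\right)_4$, for an odd prime $p$, is the product of $\left(\frac{\alpha}{\pi}\right)_4$ over the prime factors $\pi$ of $p$ in $\mathbb Z[i]$. For $c\in\mathbb Z_p$ put $\left(\frac{c+i}{p}\right)_4=\left(\frac{n+i}{p}\right)_4$, where $n$ is any integer with $n\equiv c\pmod p$, and for $r\in\{0,1,2,3\}$ let $$Q_r(p)=\Big\{c\in\mathbb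 Z_p:\ \Big(\frac{c+i}{p}\Big)_4=i^r\Big\}.$$ **Theorem 3.1.** Let $p$ be an odd prime, $c\in\mathbb Z_p$ and $c(c^2+1)\not\equiv 0\pmod p$. Then $$2c\sum_{k=(p+1)/2}^{[3p/4]}\binom{4k}{2k}\frac1{(16(c^2+1))^k}\equiv -4c\sum_{k=1}^{[(p+1)/4]}\binom{4k-2}{2k-1}\frac1{(16(c^2+1))^k}\equiv\begin{cases}0\pmod p&\text{if }\left(\frac{c^2+1}p\right)=1,\\ 1\pmod p&\text{if }c\in Q_1(p),\\ -1\pmod p&\text{if }c\in Q_3(p).\end{cases}$$ -/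

import Mathlib

/-- `ℤ_p` (in the sense of localization): the rational numbers whose denominator in lowest
terms is not divisible by `p`. -/
def pIntegers (p : ℕ) : Set ℚ := {x | ¬ p ∣ x.den}

/-- Congruence modulo `p` of rational numbers: `x ≡ y (mod p)` if `x - y ∈ p ℤ_p`. -/
def RatModEq (p : ℕ) (x y : ℚ) : Prop := ∃ z ∈ pIntegers p, x - y = p * z

/-- The integer in `{0, …, p - 1}` that is congruent to `x ∈ ℤ_p` modulo `p`
(see `ratModEq_ratResidue`). -/
def ratResidue (p : ℕ) (x : ℚ) : ℤ := (((x.num : ZMod p) * (x.den : ZMod p)⁻¹).val : ℤ)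

theorem ratModEq_ratResidue (p : ℕ) [Fact p.Prime] {x : ℚ} (hx : x ∈ pIntegers p) :
    RatModEq p x (ratResidue p x) := by
  have hden : (x.den : ZMod p) ≠ 0 := by
    rwa [Ne, ZMod.natCast_eq_zero_iff]
  have h : (p : ℤ) ∣ x.num - ratResidue p x * x.den := by
    rw [← ZMod.intCast_zmod_eq_zero_iff_dvd]
    simp [ratResidue, mul_assoc, inv_mul_cancel₀ hden]
  obtain ⟨t, ht⟩ := h
  have hd0 : (x.den : ℚ) ≠ 0 := by exact_mod_cast x.den_nz
  refine ⟨(t : ℚ) / x.den, ?_, ?_⟩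
  · intro hp
    apply hx
    have h1 : (((t : ℚ) / ((x.den : ℤ) : ℚ)).den : ℤ) ∣ (x.den : ℤ) := by
      rw [← Rat.divInt_eq_div]
      exact Rat.den_dvd t x.den
    have h2 : ((t : ℚ) / (x.den : ℚ)).den ∣ x.den := by
      exact_mod_cast h1
    exact hp.trans h2
  · have h3 : (x.num : ℚ) - ratResidue p x * x.den = p * t := by exact_mod_cast ht
    have h4 : x * x.den = x.num := Rat.mul_den_eq_num x
    rw [← mul_div_assoc, ← h3, ← h4]
    field_simp

/-- The Legendre symbol `(x/p)` for `x ∈ ℤ_p`. -/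
def ratLegendreSym (p : ℕ) [Fact p.Prime] (x : ℚ) : ℤ := legendreSym p (ratResidue p x)

/-- The imaginary unit `i` of `ℤ[i]`. -/
def gaussI : GaussianInt := ⟨0, 1⟩

open scoped Classical in
/-- The quartic residue symbol `(α/π)₄` for a prime `π` of `ℤ[i]` not dividing `2`: it is `0` if
`π ∣ α`, and otherwise it is the unique `iʳ`, `r ∈ {0, 1, 2, 3}`, with
`α ^ ((N π - 1) / 4) ≡ iʳ (mod π)`. -/
noncomputable def quarticResidueSym (α π : GaussianInt) : GaussianInt :=
  if π ∣ α then 0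
  else if π ∣ α ^ ((π.norm.natAbs - 1) / 4) - 1 then 1
  else if π ∣ α ^ ((π.norm.natAbs - 1) / 4) - gaussI then gaussI
  else if π ∣ α ^ ((π.norm.natAbs - 1) / 4) - gaussI ^ 2 then gaussI ^ 2
  else if π ∣ α ^ ((π.norm.natAbs - 1) / 4) - gaussI ^ 3 then gaussI ^ 3
  else 0

/-- The quartic Jacobi symbol `(α/β)₄` for `β ∈ ℤ[i]` nonzero and prime to `2`: the product of the
quartic residue symbols `(α/π)₄` over the prime factors `π` of `β`, counted with multiplicity.
(The symbol `(α/π)₄` does not change when `π` is replaced by an associate.) -/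
noncomputable def quarticJacobiSym (α β : GaussianInt) : GaussianInt :=
  ((UniqueFactorizationMonoid.factors β).map (quarticResidueSym α)).prod

/-- The quartic Jacobi symbol depends on its upper entry only modulo the lower one. -/
theorem quarticJacobiSym_congr {α α' β : GaussianInt} (h : β ∣ α - α') :
    quarticJacobiSym α β = quarticJacobiSym α' β := by
  unfold quarticJacobiSym
  congr 1
  apply Multiset.map_congr rfl
  intro π hπ
  have h1 : π ∣ α - α' := (UniqueFactorizationMonoid.dvd_of_mem_factors hπ).trans h
  have h2 : ∀ (n : ℕ) (u : GaussianInt), π ∣ α ^ n - u ↔ π ∣ α' ^ n - u := by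
    intro n u
    have h3 : π ∣ α ^ n - α' ^ n := h1.trans (sub_dvd_pow_sub_pow α α' n)
    constructor
    · intro h4
      have := dvd_sub h4 h3
      simpa using this
    · intro h4
      have := dvd_add h4 h3
      simpa [add_comm] using this
  have h5 : π ∣ α ↔ π ∣ α' := by simpa using h2 1 0
  unfold quarticResidueSym
  rw [propext h5, propext (h2 _ 1), propext (h2 _ gaussI), propext (h2 _ (gaussI ^ 2)),
    propext (h2 _ (gaussI ^ 3))]

/-- The quartic Jacobi symbol `((a + b i)/p)₄` for `a, b ∈ ℤ_p`, obtained by replacing `a` and `b`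
by integers congruent to them modulo `p`. -/
noncomputable def ratQuarticSym (p : ℕ) (a b : ℚ) : GaussianInt :=
  quarticJacobiSym ⟨ratResidue p a, ratResidue p b⟩ (p : GaussianInt)

/-- `Q_r(p) = {c ∈ ℤ_p : ((c + i)/p)₄ = iʳ}`. -/
def quarticClass (r p : ℕ) : Set ℚ := {c | c ∈ pIntegers p ∧ ratQuarticSym p c 1 = gaussI ^ r}

/-! Write `p = 2n + 1`, `D = c² + 1`, and let `w² = D` in a field of characteristic `p`. Since `n ≡
-1/2`, `binom(2m, m) ≡ (-4)^m binom(n, m)` for `m ≤ n`, so the lower sum `S` is the odd part of a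
binomial expansion: `-4S = ((1 + 1/w)^n - (1 - 1/w)^n) / (2w)` (`oddCentralSum_eq`). By Lucas the
upper sum is `2 D^(-n) S`.

If `D` is a square mod `p`, then `(1 + 1/w)(1 - 1/w) = (c/w)²` with `c/w` in the prime field; the
two `n`-th powers agree and `S = 0`. Otherwise `D^n = -1`, which already makes the two sides of the
first congruence agree.

For the quartic classes, Frobenius negates `w`, and the closed form becomes `-4cS · w(1 + 1/w)^(n+1)
= c`. With `j² = -1`, `u² = c + j`, `v² = c - j`, `w = uv`, the root of `1 + w` denests: `(1 + w)(1
+ j)² = (u + jv)²`. So only `(p+1)`-th powers remain, which Frobenius evaluates, together with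
`(uv)^n`, which carries the quartic symbol `j^r`. The outcome is `-j^(r+1)`, that is, `1` for `r =
1` and `-1` for `r = 3`. -/

open Finset

/-! ### Reduction of `p`-integral rationals to `ZMod p` -/

/-- `x` is a `p`-integral rational number whose reduction modulo `p` is `a`. -/
def ReducesTo (p : ℕ) [Fact p.Prime] (x : ℚ) (a : ZMod p) : Prop :=
  x ∈ pIntegers p ∧ (x : ZMod p) = a

namespace ReducesTo

variable {p : ℕ} [Fact p.Prime] {x y : ℚ} {a b : ZMod p}

theorem den_ne_zero (hx : x ∈ pIntegers p) : (x.den : ZMod p) ≠ 0 := by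
  rwa [Ne, ZMod.natCast_eq_zero_iff]

theorem natCast (n : ℕ) : ReducesTo p n n := by
  refine ⟨?_, by simp⟩
  simpa [pIntegers] using (Fact.out : p.Prime).one_lt.ne'

theorem intCast (n : ℤ) : ReducesTo p n n := by
  refine ⟨?_, by simp⟩
  simpa [pIntegers] using (Fact.out : p.Prime).one_lt.ne'

theorem zero : ReducesTo p 0 0 := by simpa using natCast (p := p) 0

theorem one : ReducesTo p 1 1 := by simpa using natCast (p := p) 1

theorem add (hx : ReducesTo p x a) (hy : ReducesTo p y b) : ReducesTo p (x + y) (a + b) := by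
  refine ⟨fun h => ?_, ?_⟩
  · rcases (Fact.out : p.Prime).dvd_mul.1 (h.trans (Rat.add_den_dvd x y)) with h | h
    exacts [hx.1 h, hy.1 h]
  · rw [Rat.cast_add_of_ne_zero (den_ne_zero hx.1) (den_ne_zero hy.1), hx.2, hy.2]

theorem mul (hx : ReducesTo p x a) (hy : ReducesTo p y b) : ReducesTo p (x * y) (a * b) := by
  refine ⟨fun h => ?_, ?_⟩
  · rcases (Fact.out : p.Prime).dvd_mul.1 (h.trans (Rat.mul_den_dvd x y)) with h | h
    exacts [hx.1 h, hy.1 h]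
  · rw [Rat.cast_mul_of_ne_zero (den_ne_zero hx.1) (den_ne_zero hy.1), hx.2, hy.2]

theorem pow (hx : ReducesTo p x a) (n : ℕ) : ReducesTo p (x ^ n) (a ^ n) := by
  induction n with
  | zero => simpa using one
  | succ n ih => simpa only [pow_succ] using ih.mul hx

theorem neg (hx : ReducesTo p x a) : ReducesTo p (-x) (-a) := by
  simpa using (intCast (p := p) (-1)).mul hx

theorem sub (hx : ReducesTo p x a) (hy : ReducesTo p y b) : ReducesTo p (x - y) (a - b) := by
  simpa only [sub_eq_add_neg] using hx.add hy.neg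

theorem one_div_of_ne_zero (hx : ReducesTo p x a) (ha : a ≠ 0) : ReducesTo p (1 / x) (1 / a) := by
  have h : (x.num : ZMod p) ≠ 0 := by
    rintro h
    apply ha
    rw [← hx.2, Rat.cast_def, h, zero_div]
  refine ⟨?_, ?_⟩
  · intro hd
    apply h
    rw [one_div, Rat.den_inv] at hd
    rw [ZMod.intCast_zmod_eq_zero_iff_dvd]
    split_ifs at hd with h0
    · simp [h0]
    · exact Int.natCast_dvd.2 hd
  · rw [one_div, one_div, Rat.cast_inv_of_ne_zero h, hx.2]

theorem sum {ι : Type*} (s : Finset ι) {f : ι → ℚ} {g : ι → ZMod p}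
    (h : ∀ i ∈ s, ReducesTo p (f i) (g i)) : ReducesTo p (∑ i ∈ s, f i) (∑ i ∈ s, g i) := by
  classical
  induction s using Finset.induction_on with
  | empty => simpa using zero
  | insert i s hi ih =>
    rw [Finset.sum_insert hi, Finset.sum_insert hi]
    exact (h i (Finset.mem_insert_self i s)).add
      (ih fun j hj => h j (Finset.mem_insert_of_mem hj))

theorem ratModEq_zero (hx : ReducesTo p x 0) : RatModEq p x 0 := by
  have hd : (x.den : ZMod p) ≠ 0 := den_ne_zero hx.1
  have hn : (p : ℤ) ∣ x.num := by
    rw [← ZMod.intCast_zmod_eq_zero_iff_dvd]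
    have := hx.2
    rw [Rat.cast_def, div_eq_zero_iff] at this
    exact this.resolve_right hd
  obtain ⟨t, ht⟩ := hn
  refine ⟨t * (1 / x.den), ?_, ?_⟩
  · exact ((intCast t).mul ((natCast x.den).one_div_of_ne_zero hd)).1
  · rw [sub_zero]
    nth_rw 1 [← Rat.num_div_den x]
    rw [ht]
    push_cast
    ring

theorem ratModEq (hx : ReducesTo p x a) (hy : ReducesTo p y a) : RatModEq p x y := by
  have h : ReducesTo p (x - y) 0 := by simpa using hx.sub hy
  simpa [RatModEq] using h.ratModEq_zero

theorem ratResidue_cast (x : ℚ) : ((ratResidue p x : ℤ) : ZMod p) = (x : ZMod p) := by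
  simp [ratResidue, Rat.cast_def, div_eq_mul_inv]

end ReducesTo

/-! ### Closed form of the lower sum -/

/-- The sum of `binom(2m, m) / (4√D)^(m+1)` over the odd `m ≤ (p - 1) / 2`. -/
def oddCentralSum {K : Type*} [Field K] (p : ℕ) (D : K) : K :=
  ∑ k ∈ Icc 1 ((p + 1) / 4), ((4 * k - 2).choose (2 * k - 1) : K) * (1 / (16 * D) ^ k)

theorem natCast_ne_zero_of_lt {K : Type*} [Field K] {p : ℕ} [CharP K p] {m : ℕ} (h0 : m ≠ 0)
    (h : m < p) : (m : K) ≠ 0 := by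
  rw [Ne, CharP.cast_eq_zero_iff K p]
  exact Nat.not_dvd_of_pos_of_lt (Nat.pos_of_ne_zero h0) h

theorem two_ne_zero_of_odd_char {K : Type*} [Field K] {p n : ℕ} [Fact p.Prime] [CharP K p]
    (hn : p = 2 * n + 1) : (2 : K) ≠ 0 := by
  have := (Fact.out : p.Prime).one_lt
  exact_mod_cast natCast_ne_zero_of_lt (K := K) (p := p) two_ne_zero (by omega)

/-- The identity `binom(2m, m) = (-4)^m binom(-1/2, m)`, with `n` in place of `-1/2`; the induction
compares consecutive ratios, and `2n = -1` makes them agree. -/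
theorem centralBinom_eq_neg_four_pow_mul_choose {K : Type*} [Field K] {p n : ℕ} [CharP K p]
    (hn : p = 2 * n + 1) (m : ℕ) (hm : m ≤ n) :
    (m.centralBinom : K) = (-4) ^ m * (n.choose m : K) := by
  induction m with
  | zero => simp
  | succ m ih =>
    have hm0 : ((m + 1 : ℕ) : K) ≠ 0 := natCast_ne_zero_of_lt (p := p) (by omega) (by omega)
    have h1 : (((m + 1) * (m + 1).centralBinom : ℕ) : K) = (2 * (2 * m + 1) * m.centralBinom : ℕ) :=
      congrArg _ (Nat.succ_mul_centralBinom_succ m)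
    have h2 : ((n.choose (m + 1) * (m + 1) : ℕ) : K) = (n.choose m * (n - m) : ℕ) :=
      congrArg _ (Nat.choose_succ_right_eq n m)
    have h3 : (2 : K) * n = -1 := by
      have : (p : K) = 0 := CharP.cast_eq_zero K p
      rw [hn] at this
      push_cast at this
      linear_combination this
    apply mul_left_cancel₀ hm0
    rw [Nat.cast_mul, Nat.cast_mul, Nat.cast_sub (by omega)] at h2
    rw [Nat.cast_mul, Nat.cast_mul, ih (by omega)] at h1
    rw [h1]
    push_cast at h2 ⊢
    linear_combination (-4) * (-4) ^ m * (-h2) + (-4) ^ m * (n.choose m : K) * (2 * h3)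

theorem sum_range_eq_sum_odd {M : Type*} [AddCommMonoid M] (n : ℕ) (f : ℕ → M)
    (hf : ∀ m, Even m → f m = 0) :
    ∑ k ∈ Icc 1 ((n + 1) / 2), f (2 * k - 1) = ∑ m ∈ range (n + 1), f m := by
  refine Finset.sum_of_injOn (fun k => 2 * k - 1) ?_ ?_ ?_ ?_
  · intro a ha b hb hab
    simp only [coe_Icc, Set.mem_Icc] at ha hb hab
    omega
  · intro a ha
    simp only [coe_Icc, Set.mem_Icc, coe_range, Set.mem_Iio] at ha ⊢
    omega
  · intro m hm hm'
    apply hf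
    by_contra hodd
    rw [Nat.not_even_iff_odd] at hodd
    obtain ⟨t, rfl⟩ := hodd
    apply hm'
    rw [mem_range] at hm
    refine ⟨t + 1, ?_, ?_⟩
    · simp only [coe_Icc, Set.mem_Icc]
      omega
    · show 2 * (t + 1) - 1 = 2 * t + 1
      omega
  · intros; rfl

/-- Since `(16w²)^k = (4w)^(m+1)` for `m = 2k - 1`, the powers of 4 cancel. The field is general
because `w` need not lie in `ZMod p`. -/
theorem oddCentralSum_eq {K : Type*} [Field K] {p n : ℕ} [Fact p.Prime] [CharP K p]
    (hn : p = 2 * n + 1) {w : K} (hw : w ≠ 0) :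
    -4 * oddCentralSum p (w ^ 2) = w⁻¹ / 2 * ((1 + w⁻¹) ^ n - (1 - w⁻¹) ^ n) := by
  have h2 : (2 : K) ≠ 0 := two_ne_zero_of_odd_char hn
  have key : ∀ k ∈ Icc 1 ((p + 1) / 4),
      -4 * (((4 * k - 2).choose (2 * k - 1) : K) * (1 / (16 * w ^ 2) ^ k)) =
        w⁻¹ / 2 * (w⁻¹ ^ (2 * k - 1) * (n.choose (2 * k - 1) : K) -
          (-w⁻¹) ^ (2 * k - 1) * (n.choose (2 * k - 1) : K)) := by
    intro k hk
    rw [mem_Icc] at hk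
    obtain ⟨t, rfl⟩ : ∃ t, k = t + 1 := ⟨k - 1, by omega⟩
    have e : 2 * (t + 1) - 1 = 2 * t + 1 := by omega
    have e' : 4 * (t + 1) - 2 = 2 * (2 * t + 1) := by omega
    have h := centralBinom_eq_neg_four_pow_mul_choose (K := K) hn (2 * t + 1) (by omega)
    rw [Nat.centralBinom] at h
    rw [e, e', h, Odd.neg_pow ⟨t, rfl⟩, Odd.neg_pow ⟨t, rfl⟩]
    have h4 : (4 : K) ^ (2 * t) = 16 ^ t := by rw [pow_mul]; norm_num
    have h16 : (16 : K) ≠ 0 := by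
      have : (16 : K) = 2 ^ 4 := by norm_num
      rw [this]; exact pow_ne_zero 4 h2
    have hinv : (1 / (16 * w ^ 2) ^ (t + 1) : K) = 1 / 16 ^ (t + 1) * w⁻¹ ^ (2 * t + 2) := by
      rw [mul_pow, ← pow_mul, inv_pow, show 2 * (t + 1) = 2 * t + 2 by ring]
      field_simp
    rw [hinv, pow_succ, h4]
    generalize w⁻¹ = s
    field_simp
    ring
  rw [oddCentralSum, mul_sum, sum_congr rfl key, ← mul_sum]
  congr 1
  have e : (p + 1) / 4 = (n + 1) / 2 := by omega
  rw [e, sum_range_eq_sum_odd n (fun m => w⁻¹ ^ m * (n.choose m : K) - (-w⁻¹) ^ m * (n.choose m : K)),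
    sum_sub_distrib, add_comm 1, sub_eq_add_neg 1, add_comm 1, add_pow, add_pow]
  · simp
  · intro m hm
    simp [hm.neg_pow]

/-! ### Vanishing when `c² + 1` is a square -/

theorem oddCentralSum_eq_zero {p n : ℕ} [Fact p.Prime] (hn : p = 2 * n + 1) {c : ZMod p}
    (hc : c ≠ 0) (hD : c ^ 2 + 1 ≠ 0) (hres : (c ^ 2 + 1) ^ n = 1) :
    oddCentralSum p (c ^ 2 + 1) = 0 := by
  have h2 : (2 : ZMod p) ≠ 0 := two_ne_zero_of_odd_char hn
  have hp2 : p / 2 = n := by omega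
  have hp1 : p - 1 = 2 * n := by omega
  obtain ⟨w, hw⟩ := (ZMod.euler_criterion p hD).2 (by rwa [hp2])
  rw [← sq] at hw
  have hw0 : w ≠ 0 := by rintro rfl; exact hD (by simpa using hw)
  have h := oddCentralSum_eq hn hw0
  have hpr : (1 + w⁻¹) * (1 - w⁻¹) = (c * w⁻¹) ^ 2 := by
    field_simp
    linear_combination -hw
  have hcw : c * w⁻¹ ≠ 0 := mul_ne_zero hc (inv_ne_zero hw0)
  have hprn : (1 + w⁻¹) ^ n * (1 - w⁻¹) ^ n = 1 := by
    rw [← mul_pow, hpr, ← pow_mul, ← hp1, ZMod.pow_card_sub_one_eq_one hcw]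
  have ha : 1 + w⁻¹ ≠ 0 := by
    intro h0
    rw [h0, zero_mul] at hpr
    exact pow_ne_zero 2 hcw hpr.symm
  -- `(1 + 1/w)^n` is its own inverse by Fermat, and by `hprn` so is `(1 - 1/w)^n` its inverse;
  -- hence they coincide.
  have ha2 : (1 + w⁻¹) ^ n * (1 + w⁻¹) ^ n = 1 := by
    rw [← pow_add, ← two_mul, ← hp1, ZMod.pow_card_sub_one_eq_one ha]
  have heq : (1 + w⁻¹) ^ n = (1 - w⁻¹) ^ n := mul_left_cancel₀ (pow_ne_zero n ha) (ha2.trans hprn.symm)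
  rw [heq, sub_self, mul_zero, ← hw] at h
  have h4 : (-4 : ZMod p) ≠ 0 := by
    have : (-4 : ZMod p) = -(2 ^ 2) := by norm_num
    rw [this]
    exact neg_ne_zero.2 (pow_ne_zero 2 h2)
  exact (mul_eq_zero.1 h).resolve_left h4

/-! ### Comparison of the upper and lower sums -/

/-- Lucas: the base-`p` digits are `(2, 2m)` and `(1, m)`, and `binom(2, 1) = 2`. -/
theorem choose_add_char {p : ℕ} [Fact p.Prime] (m : ℕ) (hm : 2 * m < p) :
    ((2 * (p + m)).choose (p + m) : ZMod p) = 2 * ((2 * m).choose m : ZMod p) := by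
  have hp := (Fact.out : p.Prime).pos
  have h := (ZMod.natCast_eq_natCast_iff _ _ _).2
    (Choose.choose_modEq_choose_mod_mul_choose_div_nat (p := p) (n := 2 * (p + m)) (k := p + m))
  have e1 : (2 * (p + m)) % p = 2 * m := by
    rw [show 2 * (p + m) = 2 * m + p * 2 by ring, Nat.add_mul_mod_self_left, Nat.mod_eq_of_lt hm]
  have e2 : (2 * (p + m)) / p = 2 := by
    rw [show 2 * (p + m) = 2 * m + p * 2 by ring, Nat.add_mul_div_left _ _ hp,
      Nat.div_eq_of_lt hm]
  have e3 : (p + m) % p = m := by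
    rw [Nat.add_mod_left, Nat.mod_eq_of_lt (by omega)]
  have e4 : (p + m) / p = 1 := by
    rw [Nat.add_div_left _ hp, Nat.div_eq_of_lt (by omega)]
  rw [h, e1, e2, e3, e4]
  push_cast
  simp [mul_comm]

theorem upper_centralSum_eq {p n : ℕ} [Fact p.Prime] (hn : p = 2 * n + 1) {D : ZMod p}
    (hD : D ≠ 0) :
    ∑ k ∈ Icc ((p + 1) / 2) (3 * p / 4), ((4 * k).choose (2 * k) : ZMod p) * (1 / (16 * D) ^ k) =
      2 * (1 / D ^ n) * oddCentralSum p D := by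
  have h2 : (2 : ZMod p) ≠ 0 := two_ne_zero_of_odd_char hn
  have h16 : (16 : ZMod p) ^ n = 1 := by
    have h4 : (4 : ZMod p) ≠ 0 := by
      have : (4 : ZMod p) = 2 ^ 2 := by norm_num
      rw [this]
      exact pow_ne_zero 2 h2
    have h := ZMod.pow_card_sub_one_eq_one h4
    rw [show p - 1 = 2 * n by omega, pow_mul] at h
    norm_num at h
    exact h
  rw [oddCentralSum, mul_sum]
  symm
  refine Finset.sum_nbij' (fun k => n + k) (fun k => k - n) ?_ ?_ ?_ ?_ ?_
  · intro k hk
    rw [mem_Icc] at hk ⊢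
    omega
  · intro k hk
    rw [mem_Icc] at hk ⊢
    omega
  · intro k hk
    omega
  · intro k hk
    rw [mem_Icc] at hk
    omega
  · intro k hk
    rw [mem_Icc] at hk
    -- For upper index `n + k`, `2(n + k) = p + (2k - 1)` because `p = 2n + 1`.
    have h := choose_add_char (p := p) (2 * k - 1) (by omega)
    rw [show 2 * (p + (2 * k - 1)) = 4 * (n + k) by omega,
      show p + (2 * k - 1) = 2 * (n + k) by omega,
      show 2 * (2 * k - 1) = 4 * k - 2 by omega] at h
    rw [h, pow_add, mul_pow 16 D n, h16, one_mul]
    field_simp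

/-! ### Evaluation when `c² + 1` is a non-square -/

theorem oddCentralSum_mul_pow {K : Type*} [Field K] {p n : ℕ} [Fact p.Prime] [CharP K p]
    (hn : p = 2 * n + 1) {c w : K} (hcp : c ^ p = c) (hw : w ≠ 0) (hc : c ≠ 0)
    (hwD : w ^ 2 = c ^ 2 + 1) (hwp : w ^ p = -w) :
    (-4 * c * oddCentralSum p (c ^ 2 + 1)) * (w * (1 + w⁻¹) ^ (n + 1)) = c := by
  have h2 : (2 : K) ≠ 0 := two_ne_zero_of_odd_char hn
  have h := oddCentralSum_eq hn hw
  rw [hwD] at h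
  have hsp : w⁻¹ ^ p = -w⁻¹ := by rw [inv_pow, hwp, inv_neg]
  have hA : (1 + w⁻¹) ^ n * (1 + w⁻¹) ^ (n + 1) = 1 - w⁻¹ := by
    rw [← pow_add, show n + (n + 1) = p by omega, add_pow_char, hsp, one_pow, sub_eq_add_neg]
  have hcw : c * w⁻¹ ≠ 0 := mul_ne_zero hc (inv_ne_zero hw)
  have hpr : (1 - w⁻¹) * (1 + w⁻¹) = (c * w⁻¹) ^ 2 := by
    field_simp
    linear_combination hwD
  -- Frobenius negates `c/w`, so `(c/w)^(p-1) = -1`.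
  have hAB : (1 - w⁻¹) ^ n * (1 + w⁻¹) ^ n = -1 := by
    rw [← mul_pow, hpr, ← pow_mul]
    apply mul_right_cancel₀ hcw
    rw [← pow_succ, ← hn, mul_pow, hcp, hsp]
    ring
  have hww : w * w⁻¹ = 1 := mul_inv_cancel₀ hw
  have key : ((1 + w⁻¹) ^ n - (1 - w⁻¹) ^ n) * (1 + w⁻¹) ^ (n + 1) = 2 := by
    rw [sub_mul, hA, pow_succ, ← mul_assoc, hAB]
    ring
  calc _ = c * (-4 * oddCentralSum p (c ^ 2 + 1)) * (w * (1 + w⁻¹) ^ (n + 1)) := by ring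
    _ = c / 2 * (w * w⁻¹) * (((1 + w⁻¹) ^ n - (1 - w⁻¹) ^ n) * (1 + w⁻¹) ^ (n + 1)) := by
      rw [h]; ring
    _ = c := by rw [key, hww]; field_simp

theorem oddCentralSum_mul_add_pow {K : Type*} [Field K] {p n : ℕ} [Fact p.Prime] [CharP K p]
    (hn : p = 2 * n + 1) {c j u v : K} (hcp : c ^ p = c) (hc : c ≠ 0) (hj : j ^ 2 = -1)
    (hu : u ^ 2 = c + j) (hv : v ^ 2 = c - j) (hw : u * v ≠ 0) (hwp : (u * v) ^ p = -(u * v)) :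
    (-4 * c * oddCentralSum p (c ^ 2 + 1)) * (u + j * v) ^ (p + 1) =
      c * (u * v) ^ n * (1 + j) ^ (p + 1) := by
  have hwD : (u * v) ^ 2 = c ^ 2 + 1 := by
    rw [mul_pow, hu, hv]
    linear_combination -hj
  have h := oddCentralSum_mul_pow hn hcp hw hc hwD hwp
  have hww : u * v * (u * v)⁻¹ = 1 := mul_inv_cancel₀ hw
  -- Denesting: `(u + jv)² = u² - v² + 2juv = 2j(1 + uv)`, and `(1 + j)² = 2j`.
  have hsq : (1 + (u * v)⁻¹) * (u * v) * (1 + j) ^ 2 = (u + j * v) ^ 2 := by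
    linear_combination (1 + j) ^ 2 * hww + (1 - v ^ 2 + u * v) * hj - hu + hv
  generalize u * v = w at *
  have hpow : (1 + w⁻¹) ^ (n + 1) * w ^ (n + 1) * (1 + j) ^ (p + 1) =
      (u + j * v) ^ (p + 1) := by
    rw [show p + 1 = 2 * (n + 1) by omega, pow_mul, pow_mul, ← hsq, mul_pow, mul_pow]
  rw [← hpow]
  linear_combination w ^ n * (1 + j) ^ (p + 1) * h

theorem mul_pow_char_eq_neg {K : Type*} [Field K] {p n : ℕ} (hn : p = 2 * n + 1) {c j u v : K}
    (hj : j ^ 2 = -1) (hu : u ^ 2 = c + j) (hv : v ^ 2 = c - j) (hD : (c ^ 2 + 1) ^ n = -1) :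
    (u * v) ^ p = -(u * v) := by
  have hwD : (u * v) ^ 2 = c ^ 2 + 1 := by
    rw [mul_pow, hu, hv]
    linear_combination -hj
  rw [hn, pow_succ, pow_mul, hwD, hD, neg_one_mul]

theorem exists_sign_of_sq_eq {K : Type*} [Field K] {a b : K} (h : a ^ 2 = b ^ 2) :
    ∃ e : K, (e = 1 ∨ e = -1) ∧ a = e * b := by
  rcases sq_eq_sq_iff_eq_or_eq_neg.1 h with h | h
  exacts [⟨1, Or.inl rfl, by simpa using h⟩, ⟨-1, Or.inr rfl, by simpa using h⟩]

/-- For odd `n` Frobenius negates `j`, hence swaps `u` and `v` up to opposite signs `e`, `-e`. The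
sign `e` cancels in the end. -/
theorem oddCentralSum_of_inert {K : Type*} [Field K] {p n E : ℕ} [Fact p.Prime] [CharP K p]
    (hn : p = 2 * n + 1) (hodd : Odd n) (hE : (p + 1) * n = 2 * E) {c j u v : K} {r : ℕ}
    (hcp : c ^ p = c) (hc : c ≠ 0) (hj : j ^ 2 = -1) (hu : u ^ 2 = c + j) (hv : v ^ 2 = c - j)
    (hD : (c ^ 2 + 1) ^ n = -1) (hr : (c + j) ^ E = j ^ r) :
    -4 * c * oddCentralSum p (c ^ 2 + 1) = -j ^ (r + 1) := by
  have h2 : (2 : K) ≠ 0 := two_ne_zero_of_odd_char hn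
  have hj0 : j ≠ 0 := by rintro rfl; norm_num at hj
  have hwp := mul_pow_char_eq_neg hn hj hu hv hD
  have hw : u * v ≠ 0 := by
    intro h0
    have hwD : (u * v) ^ 2 = c ^ 2 + 1 := by
      rw [mul_pow, hu, hv]
      linear_combination -hj
    rw [← hwD, h0, zero_pow two_ne_zero, zero_pow hodd.pos.ne'] at hD
    norm_num at hD
  have hjp : j ^ p = -j := by rw [hn, pow_succ, pow_mul, hj, hodd.neg_one_pow, neg_one_mul]
  have h := oddCentralSum_mul_add_pow hn hcp hc hj hu hv hw hwp
  obtain ⟨e, he, hup⟩ : ∃ e : K, (e = 1 ∨ e = -1) ∧ u ^ p = e * v := by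
    apply exists_sign_of_sq_eq
    rw [← pow_mul, mul_comm, pow_mul, hu, hv, add_pow_char, hcp, hjp, sub_eq_add_neg]
  have he2 : e ^ 2 = 1 := by rcases he with rfl | rfl <;> norm_num
  have hen : e ^ n = e := by
    rcases he with rfl | rfl
    · rw [one_pow]
    · rw [hodd.neg_one_pow]
  have he0 : e ≠ 0 := by rintro rfl; norm_num at he2
  have hvp : v ^ p = -e * u := by
    apply mul_left_cancel₀ (mul_ne_zero he0 (right_ne_zero_of_mul hw))
    rw [← hup, ← mul_pow, hwp, hup]
    linear_combination u * v * he2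
  have h1 : (u + j * v) ^ (p + 1) = 2 * c * (e * j) := by
    rw [pow_succ, add_pow_char, mul_pow, hjp, hup, hvp]
    linear_combination e * j * (hu + hv) + e * u * v * hj
  have h3 : (1 + j) ^ (p + 1) = 2 := by
    rw [pow_succ, add_pow_char, hjp, one_pow]
    linear_combination -hj
  -- `uv` is `e` times the norm `u^(p+1)`, so its `n`-th power is `e · u^(2E) = e(c + j)^E`.
  have h4 : (u * v) ^ n = e * j ^ r := by
    have : u * v = e * u ^ (p + 1) := by
      rw [pow_succ, hup]
      linear_combination -u * v * he2
    rw [this, mul_pow, hen, ← pow_mul, hE, pow_mul, hu, hr]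
  rw [h1, h3, h4] at h
  apply mul_right_cancel₀ (mul_ne_zero (mul_ne_zero h2 hc) (mul_ne_zero he0 hj0))
  rw [h]
  linear_combination (2 : K) * c * e * j ^ r * hj

/-- For even `n` Frobenius fixes `j`, hence fixes `u` and `v` up to opposite signs. The quartic
symbol enters as the ratio `(u/v)^n`. -/
theorem oddCentralSum_of_split {K : Type*} [Field K] {p n E : ℕ} [Fact p.Prime] [CharP K p]
    (hn : p = 2 * n + 1) (hE : n = 2 * E) {c j u v : K} {r : ℕ}
    (hcp : c ^ p = c) (hc : c ≠ 0) (hj : j ^ 2 = -1) (hu : u ^ 2 = c + j) (hv : v ^ 2 = c - j)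
    (hD : (c ^ 2 + 1) ^ n = -1) (hr : (c + j) ^ E = j ^ r * (c - j) ^ E) :
    -4 * c * oddCentralSum p (c ^ 2 + 1) = -j ^ (r + 1) := by
  have h2 : (2 : K) ≠ 0 := two_ne_zero_of_odd_char hn
  have heven : Even n := ⟨E, by omega⟩
  have hn0 : n ≠ 0 := by
    rintro rfl
    exact (Fact.out : p.Prime).one_lt.ne' (by simpa using hn)
  have hwp := mul_pow_char_eq_neg hn hj hu hv hD
  have hw : u * v ≠ 0 := by
    intro h0
    have hwD : (u * v) ^ 2 = c ^ 2 + 1 := by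
      rw [mul_pow, hu, hv]
      linear_combination -hj
    rw [← hwD, h0, zero_pow two_ne_zero, zero_pow hn0] at hD
    norm_num at hD
  have hu0 : u ≠ 0 := left_ne_zero_of_mul hw
  have hv0 : v ≠ 0 := right_ne_zero_of_mul hw
  have hjp : j ^ p = j := by rw [hn, pow_succ, pow_mul, hj, heven.neg_one_pow, one_mul]
  have h := oddCentralSum_mul_add_pow hn hcp hc hj hu hv hw hwp
  obtain ⟨e, he, hup⟩ : ∃ e : K, (e = 1 ∨ e = -1) ∧ u ^ p = e * u := by
    apply exists_sign_of_sq_eq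
    rw [← pow_mul, mul_comm, pow_mul, hu, add_pow_char, hcp, hjp]
  have he2 : e ^ 2 = 1 := by rcases he with rfl | rfl <;> norm_num
  have he0 : e ≠ 0 := by rintro rfl; norm_num at he2
  have hvp : v ^ p = -e * v := by
    apply mul_left_cancel₀ (mul_ne_zero he0 hu0)
    rw [← hup, ← mul_pow, hwp, hup]
    linear_combination u * v * he2
  have h1 : (u + j * v) ^ (p + 1) = 2 * c * e := by
    rw [pow_succ, add_pow_char, mul_pow, hjp, hup, hvp]
    linear_combination e * (hu + hv) - e * v ^ 2 * hj
  have h3 : (1 + j) ^ (p + 1) = 2 * j := by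
    rw [pow_succ, add_pow_char, hjp, one_pow]
    linear_combination hj
  have h5 : (v ^ 2) ^ n = -e := by
    apply mul_right_cancel₀ hv0
    rw [← pow_mul, ← pow_succ, ← hn, hvp]
  have h4 : (u * v) ^ n = -e * j ^ r := by
    have hun : u ^ n = j ^ r * v ^ n := by
      rw [hE, pow_mul, pow_mul, hu, hv, hr]
    rw [mul_pow, hun, ← h5]
    ring
  rw [h1, h3, h4] at h
  apply mul_right_cancel₀ (mul_ne_zero (mul_ne_zero h2 hc) he0)
  rw [h]
  ring

/-! ### Quartic symbols as powers in characteristic `p` -/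

theorem quarticResidueSym_spec {α π : GaussianInt} (h : quarticResidueSym α π ≠ 0) :
    π ∣ α ^ ((π.norm.natAbs - 1) / 4) - quarticResidueSym α π ∧
      quarticResidueSym α π * star (quarticResidueSym α π) = 1 := by
  unfold quarticResidueSym at h ⊢
  split_ifs at h ⊢ with h0 h1 h2 h3 h4
  · exact absurd rfl h
  · exact ⟨h1, by simp⟩
  · exact ⟨h2, by decide⟩
  · exact ⟨h3, by decide⟩
  · exact ⟨h4, by decide⟩
  · exact absurd rfl h

/-- The ring homomorphism `ℤ[i] → K` sending `i` to `j`. -/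
def gaussianLift {K : Type*} [Field K] {j : K} (hj : j ^ 2 = -1) : GaussianInt →+* K :=
  Zsqrtd.lift ⟨j, by rw [← sq, hj]; simp⟩

section

variable {K : Type*} [Field K] {j : K} (hj : j ^ 2 = -1)

theorem gaussianLift_mk (a b : ℤ) : gaussianLift hj ⟨a, b⟩ = a + b * j := rfl

theorem gaussianLift_star {j' : K} (hj' : j' ^ 2 = -1) (h : j' = -j) (x : GaussianInt) :
    gaussianLift hj' x = gaussianLift hj (star x) := by
  subst h
  rw [Zsqrtd.star_mk]
  obtain ⟨a, b⟩ := x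
  rw [gaussianLift_mk, gaussianLift_mk]
  push_cast
  ring

theorem gaussianLift_gaussI : gaussianLift hj gaussI = j := by
  rw [gaussI, gaussianLift_mk]
  simp

/-- The defining congruence mod `π` becomes an equality under a homomorphism that kills `π`; the
associate `π'` absorbs the arbitrary choice of generators in `factors`. -/
theorem gaussianLift_quarticResidueSym {α π π' : GaussianInt} (h : quarticResidueSym α π ≠ 0)
    (hass : Associated π' π) (hπ : gaussianLift hj π' = 0) :
    gaussianLift hj α ^ ((π'.norm.natAbs - 1) / 4) =
      gaussianLift hj (quarticResidueSym α π) := by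
  have hn : π'.norm = π.norm := Zsqrtd.norm_eq_of_associated (by norm_num) hass
  rw [hn, ← map_pow, ← sub_eq_zero, ← map_sub]
  obtain ⟨t, ht⟩ := hass.dvd.trans (quarticResidueSym_spec h).1
  rw [ht, map_mul, hπ, zero_mul]

theorem pow_eq_of_quarticJacobiSym_inert {p : ℕ} [Fact p.Prime] [CharP K p] (hp : p % 4 = 3)
    {α : GaussianInt} {r : ℕ} (h : quarticJacobiSym α p = gaussI ^ r) :
    gaussianLift hj α ^ ((p * p - 1) / 4) = j ^ r := by
  have hprime := GaussianInt.prime_of_nat_prime_of_mod_four_eq_three p hp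
  have hrel : Multiset.Rel Associated ({(p : GaussianInt)} : Multiset GaussianInt)
      (UniqueFactorizationMonoid.factors (p : GaussianInt)) := by
    refine UniqueFactorizationMonoid.factors_unique
      (fun x hx => Multiset.mem_singleton.1 hx ▸ hprime.irreducible)
      (fun x hx => UniqueFactorizationMonoid.irreducible_of_factor x hx) ?_
    rw [Multiset.prod_singleton]
    exact (UniqueFactorizationMonoid.factors_prod hprime.ne_zero).symm
  rw [← Multiset.cons_zero, Multiset.rel_cons_left] at hrel
  obtain ⟨q, t, hq, ht, hf⟩ := hrel
  rw [Multiset.rel_zero_left] at ht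
  rw [ht, Multiset.cons_zero] at hf
  rw [quarticJacobiSym, hf, Multiset.map_singleton, Multiset.prod_singleton] at h
  have hI : gaussI ≠ 0 := by decide
  have h0 : quarticResidueSym α q ≠ 0 := by
    rw [h]
    exact pow_ne_zero r hI
  have := gaussianLift_quarticResidueSym hj h0 hq (by simp)
  rw [h, map_pow, gaussianLift_gaussI] at this
  rw [← this, Zsqrtd.norm_natCast, Int.natAbs_mul, Int.natAbs_natCast]

end

theorem GaussianInt.irreducible_of_norm_eq_prime {p : ℕ} [Fact p.Prime] {π : GaussianInt}
    (h : π.norm.natAbs = p) : Irreducible π := by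
  have hp : p.Prime := Fact.out
  refine ⟨fun hu => ?_, fun a b hab => ?_⟩
  · rw [← Zsqrtd.norm_eq_one_iff, h] at hu
    exact hp.one_lt.ne' hu
  · rw [hab, Zsqrtd.norm_mul, Int.natAbs_mul] at h
    rw [← Zsqrtd.norm_eq_one_iff, ← Zsqrtd.norm_eq_one_iff]
    exact (Nat.irreducible_iff_nat_prime _ |>.2 (h ▸ hp)).isUnit_or_isUnit rfl |>.imp
      Nat.isUnit_iff.1 Nat.isUnit_iff.1

/-- Both primes over `p` are read in `K`, through `i ↦ j` and `i ↦ -j`. The second map is the first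
after conjugation, which inverts a fourth root of unity, so the product of the two symbols becomes a
quotient of powers. -/
theorem exists_pow_eq_of_quarticJacobiSym_split {K : Type*} [Field K] {p : ℕ} [Fact p.Prime]
    [CharP K p] (hp : p % 4 = 1) {α : GaussianInt} {r : ℕ}
    (h : quarticJacobiSym α p = gaussI ^ r) :
    ∃ j : K, j ^ 2 = -1 ∧ (α.re + α.im * j) ^ ((p - 1) / 4) =
      j ^ r * (α.re - α.im * j) ^ ((p - 1) / 4) := by
  have hpp : p.Prime := Fact.out
  obtain ⟨a, b, hab⟩ := Nat.Prime.sq_add_sq (p := p) (by omega)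
  have hb0 : b ≠ 0 := by
    rintro rfl
    rw [← hab] at hpp
    simp only [ne_eq, OfNat.ofNat_ne_zero, not_false_eq_true, zero_pow, add_zero] at hpp
    exact Nat.Prime.not_prime_pow le_rfl hpp
  have hbp : b < p := by
    have := hpp.one_lt
    by_contra hle
    nlinarith
  have hbK : (b : K) ≠ 0 := natCast_ne_zero_of_lt hb0 hbp
  have habK : (a : K) ^ 2 + (b : K) ^ 2 = 0 := by
    have : (p : K) = 0 := CharP.cast_eq_zero K p
    rw [← hab] at this
    exact_mod_cast this
  have hj : (-(a : K) / b) ^ 2 = -1 := by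
    field_simp
    linear_combination habK
  have hj' : (-(-(a : K) / b)) ^ 2 = -1 := by rw [neg_sq, hj]
  -- With `p = a² + b²`, this choice of `j` sends `a + bi` to `0`, and `-j` sends `a - bi` to `0`.
  refine ⟨-a / b, hj, ?_⟩
  have hN : (Zsqrtd.norm (⟨a, b⟩ : GaussianInt)).natAbs = p := by
    rw [Zsqrtd.norm_def]
    zify
    rw [← hab]
    push_cast
    rw [show ((a : ℤ) * a - -1 * b * b) = a ^ 2 + b ^ 2 by ring, abs_of_nonneg (by positivity)]
  have hN' : (Zsqrtd.norm (⟨a, -b⟩ : GaussianInt)).natAbs = p := by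
    rw [← hN, Zsqrtd.norm_def, Zsqrtd.norm_def]
    congr 1
    ring
  have hirr : ∀ x ∈ ({⟨a, b⟩, ⟨a, -b⟩} : Multiset GaussianInt), Irreducible x := by
    intro x hx
    rw [Multiset.insert_eq_cons, Multiset.mem_cons, Multiset.mem_singleton] at hx
    rcases hx with rfl | rfl
    exacts [GaussianInt.irreducible_of_norm_eq_prime hN, GaussianInt.irreducible_of_norm_eq_prime hN']
  have hp0 : (p : GaussianInt) ≠ 0 := by exact_mod_cast hpp.ne_zero
  have hprod : ({⟨a, b⟩, ⟨a, -b⟩} : Multiset GaussianInt).prod = p := by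
    rw [Multiset.insert_eq_cons, Multiset.prod_cons, Multiset.prod_singleton, ← hab]
    ext
    · push_cast
      simp [sq]
    · simp [sq]
      ring
  have hrel : Multiset.Rel Associated ({⟨a, b⟩, ⟨a, -b⟩} : Multiset GaussianInt)
      (UniqueFactorizationMonoid.factors (p : GaussianInt)) := by
    refine UniqueFactorizationMonoid.factors_unique hirr
      (fun x hx => UniqueFactorizationMonoid.irreducible_of_factor x hx) ?_
    rw [hprod]
    exact (UniqueFactorizationMonoid.factors_prod hp0).symm
  rw [Multiset.insert_eq_cons, Multiset.rel_cons_left] at hrel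
  obtain ⟨q₁, t, hq₁, ht, hf⟩ := hrel
  rw [← Multiset.cons_zero, Multiset.rel_cons_left] at ht
  obtain ⟨q₂, t', hq₂, ht', rfl⟩ := ht
  rw [Multiset.rel_zero_left] at ht'
  subst ht'
  rw [quarticJacobiSym, hf, Multiset.map_cons, Multiset.map_cons, Multiset.map_zero,
    Multiset.prod_cons, Multiset.prod_cons, Multiset.prod_zero, mul_one] at h
  have hI : gaussI ≠ 0 := by decide
  have hne : quarticResidueSym α q₁ * quarticResidueSym α q₂ ≠ 0 := by
    rw [h]
    exact pow_ne_zero r hI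
  have hne₂ := right_ne_zero_of_mul hne
  have e₁ := gaussianLift_quarticResidueSym hj (left_ne_zero_of_mul hne) hq₁ (by
    rw [gaussianLift_mk]
    push_cast
    field_simp
    ring)
  have e₂ := gaussianLift_quarticResidueSym hj' hne₂ hq₂ (by
    rw [gaussianLift_mk]
    push_cast
    field_simp
    ring)
  rw [gaussianLift_star hj hj' rfl (quarticResidueSym α q₂), hN'] at e₂
  rw [hN] at e₁
  have hstar := congrArg (gaussianLift hj) (quarticResidueSym_spec hne₂).2
  rw [map_mul, map_one, ← e₂] at hstar
  have hmul := congrArg (gaussianLift hj) h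
  rw [map_mul, map_pow, gaussianLift_gaussI, ← e₁] at hmul
  have f₁ : gaussianLift hj α = α.re + α.im * (-(a : K) / b) := rfl
  have f₂ : gaussianLift hj' α = α.re - α.im * (-(a : K) / b) := by
    rw [sub_eq_add_neg, ← mul_neg]
    rfl
  rw [← f₁, ← f₂, ← hmul, mul_assoc, hstar, mul_one]

/-! ### Quartic classes and the final assembly -/

theorem map_oddCentralSum {K L : Type*} [Field K] [Field L] (f : K →+* L) (p : ℕ) (D : K) :
    f (oddCentralSum p D) = oddCentralSum p (f D) := by
  have h16 : f 16 = 16 := map_ofNat f 16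
  simp [oddCentralSum, h16]

/-- An odd exponent `r` forces `(c² + 1)^n = j^(2r) = -1`, so membership in the class itself puts
`c` in the non-square case. Algebraic closedness supplies `u` and `v`. -/
theorem map_oddCentralSum_of_mem_quarticClass {K : Type*} [Field K] [IsAlgClosed K] {p n : ℕ}
    [Fact p.Prime] [CharP K p] (f : ZMod p →+* K) (hn : p = 2 * n + 1) {x : ℚ}
    {c : ZMod p} (hx : ReducesTo p x c) (hc : c ≠ 0) (m : ℕ)
    (h : x ∈ quarticClass (2 * m + 1) p) :
    -4 * f c * oddCentralSum p (f c ^ 2 + 1) = (-1) ^ m := by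
  have hpp : p.Prime := Fact.out
  have hcp : f c ^ p = f c := by rw [← map_pow, ZMod.pow_card]
  have hfc : f c ≠ 0 := (map_ne_zero f).2 hc
  have hre : ((ratResidue p x : ℤ) : K) = f c := by
    rw [← hx.2, ← ReducesTo.ratResidue_cast, map_intCast]
  have him : ((ratResidue p 1 : ℤ) : K) = 1 := by
    rw [← map_intCast f, ReducesTo.ratResidue_cast, Rat.cast_one, map_one]
  have hsym := h.2
  rw [ratQuarticSym] at hsym
  have hval : ∀ j : K, j ^ 2 = -1 → -j ^ (2 * m + 1 + 1) = (-1) ^ m := by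
    intro j hj
    rw [show 2 * m + 1 + 1 = 2 * (m + 1) by ring, pow_mul, hj, pow_succ]
    ring
  have hodd : ∀ j : K, j ^ 2 = -1 → (j ^ (2 * m + 1)) ^ 2 = -1 := by
    intro j hj
    rw [← pow_mul, mul_comm, pow_mul, hj, pow_succ, pow_mul]
    norm_num
  rcases (show p % 4 = 1 ∨ p % 4 = 3 by omega) with hp4 | hp4
  · obtain ⟨j, hj, hr⟩ := exists_pow_eq_of_quarticJacobiSym_split (K := K) hp4 hsym
    simp only [hre, him, one_mul] at hr
    obtain ⟨u, hu⟩ := IsAlgClosed.exists_pow_nat_eq (f c + j) two_pos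
    obtain ⟨v, hv⟩ := IsAlgClosed.exists_pow_nat_eq (f c - j) two_pos
    have hE : n = 2 * ((p - 1) / 4) := by omega
    have hjp : j ^ p = j := by
      rw [hn, pow_succ, pow_mul, hj, Even.neg_one_pow ⟨(p - 1) / 4, by omega⟩, one_mul]
    have hE0 : (p - 1) / 4 ≠ 0 := by
      have := hpp.one_lt
      omega
    have hj0 : j ≠ 0 := by rintro rfl; norm_num at hj
    have h2 : (2 : K) ≠ 0 := two_ne_zero_of_odd_char hn
    -- If `c = j`, then `hr` gives `c = -j` as well, so `2j = 0`.
    have hne : f c - j ≠ 0 := by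
      intro h0
      rw [h0, zero_pow hE0, mul_zero] at hr
      have h1 := eq_zero_of_pow_eq_zero hr
      have : 2 * j = 0 := by linear_combination h1 - h0
      exact mul_ne_zero h2 hj0 this
    have hpow : (f c - j) ^ (2 * n) = 1 := by
      apply mul_right_cancel₀ hne
      rw [← pow_succ, ← hn, sub_pow_char, hcp, hjp, one_mul]
    have hD : (f c ^ 2 + 1) ^ n = -1 := by
      rw [show f c ^ 2 + 1 = (f c + j) * (f c - j) by linear_combination hj, mul_pow]
      nth_rw 1 [hE]
      rw [mul_comm 2, pow_mul, hr, mul_pow, hodd j hj, ← pow_mul, mul_comm _ 2, ← hE, mul_assoc,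
        ← pow_add, ← two_mul, hpow, mul_one]
    rw [oddCentralSum_of_split hn hE hcp hfc hj hu hv hD hr, hval j hj]
  · obtain ⟨j, hj⟩ := IsAlgClosed.exists_pow_nat_eq (-1 : K) two_pos
    have hr := pow_eq_of_quarticJacobiSym_inert hj hp4 hsym
    rw [gaussianLift_mk, hre, him, one_mul] at hr
    obtain ⟨u, hu⟩ := IsAlgClosed.exists_pow_nat_eq (f c + j) two_pos
    obtain ⟨v, hv⟩ := IsAlgClosed.exists_pow_nat_eq (f c - j) two_pos
    have hno : Odd n := ⟨p / 4, by omega⟩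
    -- Both sides equal `(p² - 1)/2`; 4 divides `p² - 1`, so the truncated division is exact.
    have hE : (p + 1) * n = 2 * ((p * p - 1) / 4) := by
      obtain ⟨q, rfl⟩ := hno
      have : p * p - 1 = 4 * ((2 * q + 2) * (2 * q + 1)) := by
        rw [hn]
        apply Nat.sub_eq_of_eq_add
        ring
      rw [this, Nat.mul_div_cancel_left _ (by norm_num), hn]
      ring
    have hjp : j ^ p = -j := by rw [hn, pow_succ, pow_mul, hj, hno.neg_one_pow, neg_one_mul]
    have hD : (f c ^ 2 + 1) ^ n = -1 := by
      have : f c ^ 2 + 1 = (f c + j) ^ (p + 1) := by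
        rw [pow_succ _ p, add_pow_char, hcp, hjp]
        linear_combination hj
      rw [this, ← pow_mul, hE, mul_comm 2, pow_mul, hr, hodd j hj]
    rw [oddCentralSum_of_inert hn hno hE hcp hfc hj hu hv hD hr, hval j hj]

theorem oddCentralSum_of_mem_quarticClass {p n : ℕ} [Fact p.Prime] (hn : p = 2 * n + 1) {x : ℚ}
    {c : ZMod p} (hx : ReducesTo p x c) (hc : c ≠ 0) (m : ℕ)
    (h : x ∈ quarticClass (2 * m + 1) p) :
    -4 * c * oddCentralSum p (c ^ 2 + 1) = (-1) ^ m := by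
  let f : ZMod p →+* AlgebraicClosure (ZMod p) := algebraMap _ _
  have : CharP (AlgebraicClosure (ZMod p)) p := charP_of_injective_ringHom f.injective p
  apply f.injective
  have h4 : f 4 = 4 := map_ofNat f 4
  rw [map_mul, map_oddCentralSum]
  simpa [h4] using map_oddCentralSum_of_mem_quarticClass f hn hx hc m h

theorem theorem3p1 (p : ℕ) [Fact p.Prime] (hp : Odd p) (c : ℚ) (hc : c ∈ pIntegers p)
    (hc0 : ¬ RatModEq p (c * (c ^ 2 + 1)) 0) :
    RatModEq p
      (2 * c * ∑ k ∈ Finset.Icc ((p + 1) / 2) (3 * p / 4),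
        ((4 * k).choose (2 * k) : ℚ) * (1 / (16 * (c ^ 2 + 1)) ^ k))
      (-4 * c * ∑ k ∈ Finset.Icc 1 ((p + 1) / 4),
        ((4 * k - 2).choose (2 * k - 1) : ℚ) * (1 / (16 * (c ^ 2 + 1)) ^ k)) ∧
    (ratLegendreSym p (c ^ 2 + 1) = 1 →
      RatModEq p
        (-4 * c * ∑ k ∈ Finset.Icc 1 ((p + 1) / 4),
          ((4 * k - 2).choose (2 * k - 1) : ℚ) * (1 / (16 * (c ^ 2 + 1)) ^ k)) 0) ∧
    (c ∈ quarticClass 1 p →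
      RatModEq p
        (-4 * c * ∑ k ∈ Finset.Icc 1 ((p + 1) / 4),
          ((4 * k - 2).choose (2 * k - 1) : ℚ) * (1 / (16 * (c ^ 2 + 1)) ^ k)) 1) ∧
    (c ∈ quarticClass 3 p →
      RatModEq p
        (-4 * c * ∑ k ∈ Finset.Icc 1 ((p + 1) / 4),
          ((4 * k - 2).choose (2 * k - 1) : ℚ) * (1 / (16 * (c ^ 2 + 1)) ^ k)) (-1)) := by
  obtain ⟨n, hn⟩ := hp
  have h2 : (2 : ZMod p) ≠ 0 := two_ne_zero_of_odd_char hn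
  obtain ⟨d, hd⟩ : ∃ d : ZMod p, d = (c : ZMod p) := ⟨_, rfl⟩
  have hcd : ReducesTo p c d := ⟨hc, hd.symm⟩
  have hDd : ReducesTo p (c ^ 2 + 1) (d ^ 2 + 1) := (hcd.pow 2).add ReducesTo.one
  have hne : d * (d ^ 2 + 1) ≠ 0 := by
    intro h0
    apply hc0
    have := hcd.mul hDd
    rw [h0] at this
    exact this.ratModEq_zero
  have hd0 : d ≠ 0 := left_ne_zero_of_mul hne
  have hD0 : d ^ 2 + 1 ≠ 0 := right_ne_zero_of_mul hne
  have h16 : (16 : ZMod p) * (d ^ 2 + 1) ≠ 0 := by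
    have : (16 : ZMod p) = 2 ^ 4 := by norm_num
    rw [this]
    exact mul_ne_zero (pow_ne_zero 4 h2) hD0
  have hterm : ∀ N k : ℕ, ReducesTo p ((N : ℚ) * (1 / (16 * (c ^ 2 + 1)) ^ k))
      ((N : ZMod p) * (1 / (16 * (d ^ 2 + 1)) ^ k)) := fun N k =>
    (ReducesTo.natCast N).mul
      ((((ReducesTo.natCast 16).mul hDd).pow k).one_div_of_ne_zero (pow_ne_zero k h16))
  have hfour : ReducesTo p (-4 * c) (-4 * d) := by
    simpa using ((ReducesTo.natCast (p := p) 4).neg.mul hcd)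
  have hL := ((ReducesTo.natCast (p := p) 2).mul hcd).mul
    (ReducesTo.sum (Icc ((p + 1) / 2) (3 * p / 4)) fun k _ => hterm ((4 * k).choose (2 * k)) k)
  have hR := hfour.mul
    (ReducesTo.sum (Icc 1 ((p + 1) / 4)) fun k _ => hterm ((4 * k - 2).choose (2 * k - 1)) k)
  rw [upper_centralSum_eq hn hD0] at hL
  change ReducesTo p _ (-4 * d * oddCentralSum p (d ^ 2 + 1)) at hR
  have hp2 : p / 2 = n := by omega
  refine ⟨?_, fun hleg => ?_, fun hQ => ?_, fun hQ => ?_⟩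
  · refine hL.ratModEq ?_
    convert hR using 1
    -- The two sides are `4c D^(-n) S` and `-4cS`: they agree if `D^n = -1`, and both vanish if `D^n
    -- = 1`.
    have h := ZMod.pow_div_two_eq_neg_one_or_one p hD0
    rw [hp2] at h
    rcases h with h | h
    · rw [oddCentralSum_eq_zero hn hd0 hD0 h]
      ring
    · rw [h]
      push_cast
      ring
  · have hpow : (d ^ 2 + 1) ^ n = 1 := by
      rw [← hDd.2, ← ReducesTo.ratResidue_cast, ← hp2, ← legendreSym.eq_pow]
      rw [ratLegendreSym] at hleg
      rw [hleg, Int.cast_one]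
    rw [oddCentralSum_eq_zero hn hd0 hD0 hpow, mul_zero] at hR
    exact hR.ratModEq_zero
  · rw [oddCentralSum_of_mem_quarticClass hn hcd hd0 0 hQ, pow_zero] at hR
    exact hR.ratModEq ReducesTo.one
  · rw [oddCentralSum_of_mem_quarticClass hn hcd hd0 1 hQ, pow_one] at hR
    exact hR.ratModEq ReducesTo.one.neg
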